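/- All graphs are finite and simple. For a vertex $x$ of a graph $G$, the unit sphere $S(x)$ is the subgraph induced on the neighbours of $x$. A graph is contractible if it is the one-point graph or, inductively, if it has a vertex $x$ such that both $S(x)$ and $G-x$ are contractible. The empty graph is the only $(-1)$-sphere, and there are no $k$-spheres for $k<-1$; for $k\ge 0$ a graph is a $k$-sphere if every unit sphere is a $(k-1)$-sphere and $G-x$ is contractible for some vertex $x$. For an integer $k$, a $k$-graph is a graph all of whose unit spheres are $(k-1)$-spheres (so the empty graph is a $k$-graph for every $k$, and the only one if $k<0$). A simplex of $G$ is a non-empty complete subgraph, and $\chi(G)=\sum_{k\ge 0}(-1)^k v_k(G)$, where $v_k(G)$ is the number of simplices of $G$ with $k+1$ vertices. A function $f:V\to\mathbb{R}$ on the vertex set of $G$ is locally injective if $f(x)\ne f(y)$ whenever $x$ and $y$ are adjacent. The central surface $B_f(x)$ is the level surface $\{f=f(x)\}$ in $S(x)$: its vertices are the simplices of $S(x)$ containing both a vertex $y$ with $f(y)<f(x)$ and a vertex $z$ with $f(z)>f(x)$, and two distinct such simplices are adjacent if one contains the other. The index is $i_f(x)=1-\chi(S_f^-(x))$, where $S_f^-(x)$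 is the subgraph induced on the $y\in S(x)$ with $f(y)<f(x)$, and the symmetric index is $j_f(x)=(i_f(x)+i_{-f}(x))/2$. **Proposition.** Let $d\ge 0$ be an integer, let $G$ be a $d$-graph, let $f$ be a locally injective function on its vertex set, and let $x$ be a vertex of $G$. Then $B_f(x)$ is a $(d-2)$-graph. If $d$ is odd, then $j_f(x)=-\chi(B_f(x))/2$; if $d$ is even, then $j_f(x)=1-\chi(B_f(x))/2$. -/

import Mathlib

namespace GeomGraph

universe u

variable {V : Type u}

/-- The unit sphere `S(x)`: the subgraph induced on the neighbours of `x`. -/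
def unitSphere (G : SimpleGraph V) (x : V) : SimpleGraph (G.neighborSet x) :=
  G.induce (G.neighborSet x)

/-- The graph `G - x`, induced on all vertices different from `x`. -/
def puncture (G : SimpleGraph V) (x : V) : SimpleGraph ({x}ᶜ : Set V) :=
  G.induce ({x}ᶜ : Set V)

/-- Contractible graphs: the one-point graph is contractible, and a graph is contractible if for
some vertex `x` both `S(x)` and `G - x` are contractible. Such a graph is automatically finite. -/
inductive Contractible : ∀ {V : Type u}, SimpleGraph V → Prop
  | point {V : Type u} (G : SimpleGraph V) (hV : Nonempty (Unique V)) : Contractible G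
  | step {V : Type u} (G : SimpleGraph V) (x : V)
      (hs : Contractible (unitSphere G x)) (hp : Contractible (puncture G x)) : Contractible G

/-- `IsSphere d G`: the graph `G` is a `d`-sphere. The `(-1)`-sphere is the empty graph. For `d ≥ 0`
all unit spheres have to be `(d-1)`-spheres and removing some vertex has to make the graph
contractible. There are no `d`-spheres for `d < -1`. -/
inductive IsSphere : ∀ (_ : ℤ) {V : Type u}, SimpleGraph V → Prop
  | empty {V : Type u} (G : SimpleGraph V) (hV : IsEmpty V) : IsSphere (-1) G
  | step (d : ℤ) (hd : 0 ≤ d) {V : Type u} (G : SimpleGraph V)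
      (hs : ∀ x : V, IsSphere (d - 1) (unitSphere G x))
      (hp : ∃ x : V, Contractible (puncture G x)) : IsSphere d G

/-- A `d`-graph is a finite simple graph all of whose unit spheres are `(d-1)`-spheres.
(In particular the empty graph is a `d`-graph for all `d`, and the only one if `d < 0`.) -/
def IsDGraph (d : ℤ) (G : SimpleGraph V) : Prop :=
  Finite V ∧ ∀ x : V, IsSphere (d - 1) (unitSphere G x)

/-- The simplices of a graph: its non-empty complete subgraphs. -/
def Simplex (G : SimpleGraph V) : Type u :=
  {s : Finset V // s.Nonempty ∧ G.IsClique (s : Set V)}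

/-- The Euler characteristic `χ(G) = ∑ (-1)^(dim s)` of a finite graph, summed over all its
simplices `s`, where `dim s = |s| - 1`. -/
noncomputable def eulerChar (G : SimpleGraph V) : ℤ :=
  ∑ᶠ s : Simplex G, (-1 : ℤ) ^ (s.1.card - 1)

/-- The function `f - c` changes sign on the simplex `s`. -/
def ChangesSign (G : SimpleGraph V) (f : V → ℝ) (c : ℝ) (s : Simplex G) : Prop :=
  (∃ v ∈ s.1, f v < c) ∧ (∃ w ∈ s.1, c < f w)

/-- The level surface `{f = c}`: its vertices are the simplices of `G` on which `f - c` changes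
sign; two distinct ones are adjacent if one is contained in the other. -/
def levelSurface (G : SimpleGraph V) (f : V → ℝ) (c : ℝ) :
    SimpleGraph {s : Simplex G // ChangesSign G f c s} where
  Adj s t := s.1.1 ⊂ t.1.1 ∨ t.1.1 ⊂ s.1.1
  symm := ⟨fun _ _ h => h.symm⟩
  loopless := ⟨fun s h => h.elim (ssubset_irrefl s.1.1) (ssubset_irrefl s.1.1)⟩

/-- A function on the vertices is locally injective if it separates adjacent vertices. -/
def LocallyInjective (G : SimpleGraph V) (f : V → ℝ) : Prop :=
  ∀ x y : V, G.Adj x y → f x ≠ f y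

/-- The central surface `B_f(x)`: the level surface `{f = f(x)}` in the unit sphere `S(x)`. -/
def centralSurface (G : SimpleGraph V) (f : V → ℝ) (x : V) :
    SimpleGraph {s : Simplex (unitSphere G x) //
      ChangesSign (unitSphere G x) (fun y => f y.1) (f x) s} :=
  levelSurface (unitSphere G x) (fun y => f y.1) (f x)

/-- The graph `S⁻_f(x)` generated by the vertices `y` of `S(x)` with `f(y) < f(x)`. -/
def lowerSphere (G : SimpleGraph V) (f : V → ℝ) (x : V) :
    SimpleGraph ({y | G.Adj x y ∧ f y < f x} : Set V) :=
  G.induce ({y | G.Adj x y ∧ f y < f x} : Set V)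

/-- The Poincaré-Hopf index `i_f(x) = 1 - χ(S⁻_f(x))`. -/
noncomputable def index (G : SimpleGraph V) (f : V → ℝ) (x : V) : ℤ :=
  1 - eulerChar (lowerSphere G f x)

/-- The symmetric index `j_f(x) = (i_f(x) + i_{-f}(x)) / 2`. -/
noncomputable def symmIndex (G : SimpleGraph V) (f : V → ℝ) (x : V) : ℚ :=
  ((index G f x : ℚ) + (index G (-f) x : ℚ)) / 2

end GeomGraph

/-!
Write `S = S(x)`, a `(d - 1)`-sphere whose vertices are split by `f` into a lower part `A` and its
complement: by local injectivity, no neighbour of `x` has the value `f x`. The central surface `B`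
is the comparability graph of the poset of mixed simplices of `S`, those meeting both `A` and `Aᶜ`.

*Unit spheres of `B`.* Let `s` be a mixed simplex. The simplices properly containing `s` are mixed and
form the barycentric refinement of the link of `s` in `S`, a sphere of dimension `d - 1 - |s|`
(`IsSphereOn.link`, `IsSphereOn.cliqueExtensions`). The mixed proper subsets of `s` correspond to
the proper faces of the product of the simplices `s ∩ A` and `s \ A`, and so form a sphere of
dimension `|s| - 3` (`isSphereOn_mixedBelow`). The unit sphere of `s` in `B` is the join of the two,
a `(d - 3)`-sphere by `IsSphereOn.join`. The contractibility statements needed on the way come from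
`contractibleOn_of_closure` and its dual: a finite poset is contractible as soon as the fixed points
of a closure operator are.

*The indices.* Every mixed simplex `s` contributes `1 - χ = (-1) ^ |s|` to the Euler characteristic
of the poset `B`, where `χ` is that of the sphere below `s` (`signedCliqueCount_mixedCliques`). Hence
the mixed simplices contribute `-χ(B)` to `χ(S)`, that is, `χ(S) = χ(A) + χ(Aᶜ) - χ(B)`. As
`χ(S) = 1 - (-1) ^ d`, twice the symmetric index, `2 - χ(A) - χ(Aᶜ)`, is
`1 + (-1) ^ d - χ(B)`.
-/

namespace GeomGraph

universe u

/-! ### Contractible sets and spheres inside a fixed ambient graph -/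

/-- The subgraph of `G` induced on `F` is contractible, phrased for subsets of one fixed vertex
type, so that unit spheres and punctures are again subsets instead of iterated subtypes. -/
inductive ContractibleOn {V : Type u} (G : SimpleGraph V) : Set V → Prop
  | point (x : V) : ContractibleOn G {x}
  | step (F : Set V) (x : V) (hx : x ∈ F) (hs : ContractibleOn G (F ∩ G.neighborSet x))
      (hp : ContractibleOn G (F \ {x})) : ContractibleOn G F

/-- The subgraph of `G` induced on `F` is a `d`-sphere, phrased for subsets of one fixed vertex
type. -/
inductive IsSphereOn {V : Type u} (G : SimpleGraph V) : ℤ → Set V → Prop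
  | empty : IsSphereOn G (-1) ∅
  | step (d : ℤ) (hd : 0 ≤ d) (F : Set V)
      (hs : ∀ x ∈ F, IsSphereOn G (d - 1) (F ∩ G.neighborSet x))
      (hp : ∃ x ∈ F, ContractibleOn G (F \ {x})) : IsSphereOn G d F

section Transfer

variable {V W : Type u} {G : SimpleGraph V} {H : SimpleGraph W}

/-- The inclusion of the unit sphere `S(x)`. -/
def unitSphereEmbedding (H : SimpleGraph W) (x : W) : unitSphere H x ↪g H :=
  SimpleGraph.Embedding.induce _

/-- The inclusion of `H - x`. -/
def punctureEmbedding (H : SimpleGraph W) (x : W) : puncture H x ↪g H :=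
  SimpleGraph.Embedding.induce _

theorem range_unitSphereEmbedding (e : H ↪g G) (x : W) :
    Set.range (e.comp (unitSphereEmbedding H x)) = Set.range e ∩ G.neighborSet (e x) := by
  ext v
  constructor
  · rintro ⟨⟨y, hy⟩, rfl⟩
    exact ⟨⟨y, rfl⟩, e.map_adj_iff.2 hy⟩
  · rintro ⟨⟨y, rfl⟩, hy⟩
    exact ⟨⟨y, e.map_adj_iff.1 hy⟩, rfl⟩

theorem range_punctureEmbedding (e : H ↪g G) (x : W) :
    Set.range (e.comp (punctureEmbedding H x)) = Set.range e \ {e x} := by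
  ext v
  constructor
  · rintro ⟨⟨y, hy⟩, rfl⟩
    exact ⟨⟨y, rfl⟩, fun h => hy (e.injective h)⟩
  · rintro ⟨⟨y, rfl⟩, hy⟩
    exact ⟨⟨y, fun h => hy (congrArg e h)⟩, rfl⟩

theorem Contractible.contractibleOn_range {W : Type u} {H : SimpleGraph W} (h : Contractible H) :
    ∀ {V : Type u} {G : SimpleGraph V} (e : H ↪g G), ContractibleOn G (Set.range e) := by
  induction h with
  | point H hV =>
    intro V G e
    obtain ⟨_⟩ := hV
    rw [Set.range_unique]
    exact .point _
  | step H x _ _ ihs ihp =>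
    intro V G e
    refine .step _ (e x) ⟨x, rfl⟩ ?_ ?_
    · rw [← range_unitSphereEmbedding]; exact ihs _
    · rw [← range_punctureEmbedding]; exact ihp _

theorem ContractibleOn.contractible {F : Set V} (h : ContractibleOn G F) :
    ∀ {W : Type u} {H : SimpleGraph W} (e : H ↪g G), Set.range e = F → Contractible H := by
  induction h with
  | point x =>
    intro W H e he
    obtain ⟨y, rfl⟩ : x ∈ Set.range e := he ▸ rfl
    refine .point _ ⟨⟨⟨y⟩, fun z => e.injective ?_⟩⟩
    have : e z ∈ Set.range e := ⟨z, rfl⟩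
    rwa [he] at this
  | step F x hx _ _ ihs ihp =>
    intro W H e he
    subst he
    obtain ⟨y, rfl⟩ := hx
    exact .step _ y (ihs _ (range_unitSphereEmbedding e y)) (ihp _ (range_punctureEmbedding e y))

theorem IsSphere.isSphereOn_range {d : ℤ} {W : Type u} {H : SimpleGraph W} (h : IsSphere d H) :
    ∀ {V : Type u} {G : SimpleGraph V} (e : H ↪g G), IsSphereOn G d (Set.range e) := by
  induction h with
  | empty H hV =>
    intro V G e
    rw [Set.range_eq_empty]
    exact .empty
  | step d hd H _ hp ih =>
    intro V G e
    refine .step _ hd _ ?_ ?_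
    · rintro _ ⟨x, rfl⟩
      rw [← range_unitSphereEmbedding]; exact ih _ _
    · obtain ⟨x, hx⟩ := hp
      refine ⟨e x, ⟨x, rfl⟩, ?_⟩
      rw [← range_punctureEmbedding]
      exact hx.contractibleOn_range _

theorem IsSphereOn.isSphere {d : ℤ} {F : Set V} (h : IsSphereOn G d F) :
    ∀ {W : Type u} {H : SimpleGraph W} (e : H ↪g G), Set.range e = F → IsSphere d H := by
  induction h with
  | empty =>
    intro W H e he
    exact .empty _ (Set.range_eq_empty_iff.1 he)
  | step d hd F _ hp ih =>
    intro W H e he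
    subst he
    refine .step _ hd _ (fun x => ih _ ⟨x, rfl⟩ _ (range_unitSphereEmbedding e x)) ?_
    obtain ⟨_, ⟨x, rfl⟩, hx⟩ := hp
    exact ⟨x, hx.contractible _ (range_punctureEmbedding e x)⟩

end Transfer

/-! ### Cones and joins -/

section Join

variable {V : Type u} {G : SimpleGraph V} {A B F : Set V}

theorem ContractibleOn.finite (h : ContractibleOn G F) : F.Finite := by
  induction h with
  | point x => exact Set.finite_singleton x
  | step F x _ _ _ _ ih => exact (ih.insert x).subset (by simp)

theorem IsSphereOn.finite {d : ℤ} (h : IsSphereOn G d F) : F.Finite := by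
  cases h with
  | empty => exact Set.finite_empty
  | step _ _ _ _ hp =>
    obtain ⟨x, _, hx⟩ := hp
    exact (hx.finite.insert x).subset (by simp)

theorem contractibleOn_of_cone (hF : F.Finite) {a : V} (ha : a ∈ F)
    (h : ∀ y ∈ F, y ≠ a → G.Adj a y) : ContractibleOn G F := by
  induction hn : F.ncard using Nat.strong_induction_on generalizing F with
  | _ n ih =>
    subst hn
    by_cases hy : ∃ y ∈ F, y ≠ a
    · obtain ⟨y, hyF, hya⟩ := hy
      have hlt {F' : Set V} (h1 : F' ⊆ F) (h2 : y ∉ F') : F'.ncard < F.ncard :=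
        Set.ncard_lt_ncard (h1.ssubset_of_mem_notMem hyF h2) hF
      refine .step F y hyF ?_ ?_
      · exact ih _ (hlt Set.inter_subset_left (fun h => G.loopless.irrefl _ h.2))
          (hF.subset Set.inter_subset_left)
          ⟨ha, (h y hyF hya).symm⟩ (fun z hz => h z hz.1) rfl
      · exact ih _ (hlt Set.sdiff_subset (by simp)) (hF.subset Set.sdiff_subset)
          ⟨ha, fun h => hya h.symm⟩ (fun z hz => h z hz.1) rfl
    · push Not at hy
      rw [Set.eq_singleton_iff_unique_mem.2 ⟨ha, hy⟩]
      exact .point a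

theorem join_inter_neighborSet (h : ∀ a ∈ A, ∀ b ∈ B, G.Adj a b) {x : V} (hx : x ∈ A) :
    (A ∪ B) ∩ G.neighborSet x = A ∩ G.neighborSet x ∪ B := by
  have hB : B ⊆ G.neighborSet x := h x hx
  rw [Set.union_inter_distrib_right, Set.inter_eq_left.2 hB]

theorem join_diff_singleton (h : ∀ a ∈ A, ∀ b ∈ B, G.Adj a b) {x : V} (hx : x ∈ A) :
    (A ∪ B) \ {x} = A \ {x} ∪ B := by
  rw [Set.union_sdiff_distrib, Set.sdiff_singleton_eq_self (s := B)]
  exact fun hB => G.loopless.irrefl _ (h x hx x hB)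

theorem ContractibleOn.join (hA : ContractibleOn G A) (hB : B.Finite)
    (h : ∀ a ∈ A, ∀ b ∈ B, G.Adj a b) : ContractibleOn G (A ∪ B) := by
  induction hA with
  | point x =>
    refine contractibleOn_of_cone (a := x) ((Set.finite_singleton x).union hB) (by simp) ?_
    rintro y (hy | hy) hyx
    · exact absurd hy hyx
    · exact h x rfl y hy
  | step A x hx _ _ ihs ihp =>
    refine .step _ x (Or.inl hx) ?_ ?_
    · rw [join_inter_neighborSet h hx]; exact ihs fun a ha => h a ha.1
    · rw [join_diff_singleton h hx]; exact ihp fun a ha => h a ha.1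

theorem IsSphereOn.join {k l : ℤ} (hA : IsSphereOn G k A) (hB : IsSphereOn G l B)
    (h : ∀ a ∈ A, ∀ b ∈ B, G.Adj a b) : IsSphereOn G (k + l + 1) (A ∪ B) := by
  induction hA generalizing l B with
  | empty => rw [Set.empty_union]; convert hB using 1; ring
  | step k hk A hAs hAp ihA =>
    induction hB with
    | empty => rw [Set.union_empty]; convert IsSphereOn.step k hk A hAs hAp using 1; ring
    | step l hl B hBs hBp ihB =>
      refine .step _ (by omega) _ ?_ ?_
      · rintro x (hx | hx)
        · rw [join_inter_neighborSet h hx]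
          convert ihA x hx (.step l hl B hBs hBp) (fun a ha => h a ha.1) using 1
          ring
        · have h' : ∀ b ∈ B, ∀ a ∈ A, G.Adj b a := fun b hb a ha => (h a ha b hb).symm
          rw [Set.union_comm, join_inter_neighborSet h' hx, Set.union_comm]
          convert ihB x hx (fun a ha b hb => h a ha b hb.1) using 1
          ring
      · obtain ⟨x, hx, hxA⟩ := hAp
        refine ⟨x, Or.inl hx, ?_⟩
        rw [join_diff_singleton h hx]
        exact hxA.join (IsSphereOn.step l hl B hBs hBp).finite fun a ha => h a ha.1

/-- The link of a clique `c` in a `d`-sphere is a `(d - |c|)`-sphere. -/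
theorem IsSphereOn.link {d : ℤ} (h : IsSphereOn G d F) (c : Finset V) (hc : G.IsClique (c : Set V))
    (hcF : (c : Set V) ⊆ F) :
    IsSphereOn G (d - c.card) {v ∈ F | ∀ a ∈ c, G.Adj a v} := by
  classical
  induction c using Finset.induction_on generalizing d F with
  | empty => simpa using h
  | insert a c ha ih =>
    rw [Finset.coe_insert, Set.insert_subset_iff] at hcF
    rw [Finset.coe_insert, SimpleGraph.isClique_insert_of_notMem (by simpa using ha)] at hc
    have hs : IsSphereOn G (d - 1) (F ∩ G.neighborSet a) := by
      cases h with
      | empty => exact hcF.1.elim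
      | step _ _ _ hs _ => exact hs a hcF.1
    convert ih hs hc.1 (fun v hv => ⟨hcF.2 hv, hc.2 v hv⟩) using 1
    · rw [Finset.card_insert_of_notMem ha]; push_cast; ring
    · ext v
      simp only [Finset.forall_mem_insert, Set.mem_ofPred_eq, Set.mem_inter_iff,
        SimpleGraph.mem_neighborSet, and_assoc]

end Join

/-! ### Comparability graphs of posets -/

section Poset

variable {α : Type u} [PartialOrder α]

/-- The comparability graph of a partial order; its cliques are the chains. -/
def compGraph (α : Type u) [PartialOrder α] : SimpleGraph α where
  Adj a b := a < b ∨ b < a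
  symm := ⟨fun _ _ h => h.symm⟩
  loopless := ⟨fun a h => h.elim (lt_irrefl a) (lt_irrefl a)⟩

/-- A finite poset is contractible if the fixed points of an increasing closure operator form a
contractible poset. A maximal non-fixed point `u` has a cone with apex `φ u` as unit sphere, so
the non-fixed points can be removed from the top down. -/
theorem contractibleOn_of_closure {F : Set α} (hF : F.Finite) (φ : α → α)
    (hmem : ∀ u ∈ F, φ u ∈ F) (hle : ∀ u ∈ F, u ≤ φ u)
    (hmono : ∀ u ∈ F, ∀ v ∈ F, u ≤ v → φ u ≤ φ v) (hidem : ∀ u ∈ F, φ (φ u) = φ u)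
    (hc : ContractibleOn (compGraph α) {u ∈ F | φ u = u}) :
    ContractibleOn (compGraph α) F := by
  induction hn : F.ncard using Nat.strong_induction_on generalizing F with
  | _ n ih =>
    subst hn
    by_cases hfix : ∀ u ∈ F, φ u = u
    · rwa [show {u ∈ F | φ u = u} = F from Set.sep_eq_self_iff_mem_true.2 hfix] at hc
    push Not at hfix
    -- All elements above a maximal non-fixed point `u` are fixed, so they lie above `φ u`.
    obtain ⟨u, ⟨huF, hu⟩, hmax⟩ :=
      (hF.subset (Set.sep_subset F fun u => φ u ≠ u)).exists_maximal hfix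
    have hlt : u < φ u := lt_of_le_of_ne (hle u huF) (Ne.symm hu)
    refine .step F u huF ?_ ?_
    · refine contractibleOn_of_cone (hF.subset Set.inter_subset_left) (a := φ u)
        ⟨hmem u huF, Or.inl hlt⟩ ?_
      rintro y ⟨hyF, huy | hyu⟩ hne
      · have hy : φ y = y := by
          by_contra hy
          exact (hmax ⟨hyF, hy⟩ huy.le).not_gt huy
        have := hmono u huF y hyF huy.le
        rw [hy] at this
        exact Or.inl (lt_of_le_of_ne this hne.symm)
      · exact Or.inr (hyu.trans hlt)
    · refine ih _ (Set.ncard_sdiff_singleton_lt_of_mem huF hF) (hF.subset Set.sdiff_subset)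
        (fun v hv => ⟨hmem v hv.1, ?_⟩) (fun v hv => hle v hv.1)
        (fun v hv w hw => hmono v hv.1 w hw.1) (fun v hv => hidem v hv.1) ?_ rfl
      · rintro h
        rw [Set.mem_singleton_iff] at h
        have := hidem v hv.1
        rw [h] at this
        exact hu this
      · convert hc using 1
        ext v
        constructor
        · rintro ⟨⟨hv, _⟩, h⟩; exact ⟨hv, h⟩
        · rintro ⟨hv, h⟩
          exact ⟨⟨hv, fun hvu => hu (by rw [← Set.mem_singleton_iff.1 hvu]; exact h)⟩, h⟩

/-- The dual of `contractibleOn_of_closure`, for decreasing operators. -/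
theorem contractibleOn_of_interior {F : Set α} (hF : F.Finite) (φ : α → α)
    (hmem : ∀ u ∈ F, φ u ∈ F) (hle : ∀ u ∈ F, φ u ≤ u)
    (hmono : ∀ u ∈ F, ∀ v ∈ F, u ≤ v → φ u ≤ φ v) (hidem : ∀ u ∈ F, φ (φ u) = φ u)
    (hc : ContractibleOn (compGraph α) {u ∈ F | φ u = u}) :
    ContractibleOn (compGraph α) F := by
  have hdual : (compGraph αᵒᵈ : SimpleGraph αᵒᵈ) = (compGraph α : SimpleGraph α) := by
    ext a b
    exact or_comm
  have := contractibleOn_of_closure (α := αᵒᵈ) hF φ hmem hle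
    (fun u hu v hv h => hmono v hv u hu h) hidem
  rw [hdual] at this
  exact this hc

end Poset

/-! ### Open intervals of finite sets and refined simplex boundaries -/

section Interval

variable {V : Type u}

/-- The finite sets strictly between `s` and `t`. -/
def openInterval (s t : Finset V) : Set (Finset V) := {u | s ⊂ u ∧ u ⊂ t}

theorem finite_setOf_ssubset (t : Finset V) : {u : Finset V | u ⊂ t}.Finite := by
  classical
  exact (Finset.finite_toSet t.powerset).subset fun u hu => by
    simpa using Finset.Subset.trans hu.1 (Finset.Subset.refl t)

theorem openInterval_finite (s t : Finset V) : (openInterval s t).Finite :=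
  (finite_setOf_ssubset t).subset fun _ h => h.2

theorem openInterval_inter_neighborSet {s t u : Finset V} (hu : u ∈ openInterval s t) :
    openInterval s t ∩ (compGraph (Finset V)).neighborSet u =
      openInterval s u ∪ openInterval u t := by
  ext v
  constructor
  · rintro ⟨hv, h | h⟩
    · exact Or.inr ⟨h, hv.2⟩
    · exact Or.inl ⟨hv.1, h⟩
  · rintro (h | h)
    · exact ⟨⟨h.1, h.2.trans hu.2⟩, Or.inr h.2⟩
    · exact ⟨⟨hu.1.trans h.1, h.2⟩, Or.inl h.1⟩

/-- Removing the atom `s ∪ {w}` from an open interval leaves a contractible poset: the operator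
`u ↦ u \ {w}` retracts it to a poset with greatest element `t \ {w}`. -/
theorem contractibleOn_openInterval_diff [DecidableEq V] {s t : Finset V} {w : V} (hwt : w ∈ t)
    (hws : w ∉ s) (h : s ⊂ t.erase w) :
    ContractibleOn (compGraph (Finset V)) (openInterval s t \ {insert w s}) := by
  have hfin := (openInterval_finite s t).subset
    (Set.sdiff_subset (s := openInterval s t) (t := {insert w s}))
  refine contractibleOn_of_interior hfin (fun u => u.erase w) ?_
    (fun u _ => Finset.erase_subset w u) (fun u _ v _ huv => Finset.erase_subset_erase w huv)
    (fun u _ => by simp) ?_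
  · rintro u ⟨⟨hsu, hut⟩, hne⟩
    have hsub : s ⊆ u.erase w := Finset.subset_erase.2 ⟨hsu.1, hws⟩
    refine ⟨⟨lt_of_le_of_ne hsub ?_, lt_of_le_of_lt (Finset.erase_subset w u) hut⟩, ?_⟩
    · rintro rfl
      by_cases hw : w ∈ u
      · exact hne (Finset.insert_erase hw).symm
      · rw [Finset.erase_eq_of_notMem hw] at hsu
        exact ssubset_irrefl _ hsu
    · intro h
      have : w ∈ u.erase w := by
        rw [Set.mem_singleton_iff.1 h]; exact Finset.mem_insert_self w s
      simp at this
  · refine contractibleOn_of_cone (hfin.subset (Set.sep_subset _ _)) (a := t.erase w) ?_ ?_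
    · refine ⟨⟨⟨h, Finset.erase_ssubset hwt⟩, ?_⟩, by simp⟩
      intro h
      have : w ∈ t.erase w := by
        rw [Set.mem_singleton_iff.1 h]; exact Finset.mem_insert_self w s
      simp at this
    · rintro u ⟨⟨⟨-, hut⟩, -⟩, hu⟩ hne
      refine Or.inr (lt_of_le_of_ne ?_ hne)
      exact Finset.subset_erase.2 ⟨hut.1, Finset.erase_eq_self.1 hu⟩

/-- The finite sets strictly between `s` and `t` form the barycentric refinement of the boundary
of a simplex with `|t| - |s|` vertices, a sphere of dimension `|t| - |s| - 2`. -/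
theorem isSphereOn_openInterval {s t : Finset V} (hst : s ⊂ t) :
    IsSphereOn (compGraph (Finset V)) ((t.card : ℤ) - s.card - 2) (openInterval s t) := by
  classical
  induction hn : t.card - s.card using Nat.strong_induction_on generalizing s t with
  | _ n ih =>
    subst hn
    have hlt := Finset.card_lt_card hst
    obtain ⟨w, hwt, hws⟩ := Finset.exists_of_ssubset hst
    by_cases h1 : t.card = s.card + 1
    · rw [h1, show openInterval s t = ∅ from ?_]
      · convert IsSphereOn.empty using 1; push_cast; ring
      · refine Set.eq_empty_of_forall_notMem fun u hu => ?_
        have := Finset.card_lt_card hu.1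
        have := Finset.card_lt_card hu.2
        omega
    · refine .step _ (by omega) _ ?_ ⟨insert w s, ?_, ?_⟩
      · intro u hu
        have h1 := Finset.card_lt_card hu.1
        have h2 := Finset.card_lt_card hu.2
        rw [openInterval_inter_neighborSet hu]
        convert (ih _ (by omega) hu.1 rfl).join (ih _ (by omega) hu.2 rfl) ?_ using 1
        · ring
        · exact fun a ha b hb => Or.inl (ha.2.trans hb.1)
      · refine ⟨Finset.ssubset_insert hws, lt_of_le_of_ne ?_ ?_⟩
        · exact Finset.insert_subset hwt hst.1
        · rintro rfl
          exact h1 (Finset.card_insert_of_notMem hws)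
      · refine contractibleOn_openInterval_diff hwt hws
          (lt_of_le_of_ne (Finset.subset_erase.2 ⟨hst.1, hws⟩) ?_)
        rintro rfl
        exact h1 (Finset.card_erase_add_one hwt).symm

end Interval

/-! ### Barycentric refinements -/

section Refinement

variable {V : Type u} {G : SimpleGraph V}

/-- The finite sets `t` that properly contain `s` and for which `t \ s` is a clique of `G` inside
`W`. If `W` is disjoint from `s`, this poset is the barycentric refinement of `G` on `W`. Keeping
`s` as a parameter makes the part of a refinement above one of its vertices again of this form. -/
def cliqueExtensions (G : SimpleGraph V) (s : Finset V) (W : Set V) : Set (Finset V) :=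
  {t | s ⊂ t ∧ (∀ v ∈ t, v ∉ s → v ∈ W) ∧
    ∀ v ∈ t, ∀ v' ∈ t, v ∉ s → v' ∉ s → v ≠ v' → G.Adj v v'}

theorem cliqueExtensions_finite (G : SimpleGraph V) (s : Finset V) {W : Set V} (hW : W.Finite) :
    (cliqueExtensions G s W).Finite := by
  classical
  refine (Finset.finite_toSet (s ∪ hW.toFinset).powerset).subset fun t ht => ?_
  simp only [Finset.coe_powerset, Set.mem_preimage, Set.mem_powerset_iff, Finset.coe_subset]
  intro v hv
  by_cases hvs : v ∈ s
  · exact Finset.mem_union_left _ hvs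
  · exact Finset.mem_union_right _ (hW.mem_toFinset.2 (ht.2.1 v hv hvs))

/-- Once the vertex `s ∪ {w}` is removed from the refinement of `W`, the operator `u ↦ u \ {w}`
retracts the rest to the refinement of `W \ {w}`. -/
theorem contractibleOn_cliqueExtensions_diff [DecidableEq V] {s : Finset V} {W : Set V}
    (hW : W.Finite) {w : V} (hws : w ∉ s)
    (h : ContractibleOn (compGraph (Finset V)) (cliqueExtensions G s (W \ {w}))) :
    ContractibleOn (compGraph (Finset V)) (cliqueExtensions G s W \ {insert w s}) := by
  have hfin := (cliqueExtensions_finite G s hW).subset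
    (Set.sdiff_subset (s := cliqueExtensions G s W) (t := {insert w s}))
  have hne' (u : Finset V) (hu : w ∉ u) : u ≠ insert w s :=
    fun h => hu (h ▸ Finset.mem_insert_self w s)
  refine contractibleOn_of_interior hfin (fun u => u.erase w) ?_
    (fun u _ => Finset.erase_subset w u) (fun u _ v _ huv => Finset.erase_subset_erase w huv)
    (fun u _ => by simp) ?_
  · rintro u ⟨⟨hsu, huW, huc⟩, hne⟩
    have hsub : s ⊆ u.erase w := Finset.subset_erase.2 ⟨hsu.1, hws⟩
    refine ⟨⟨lt_of_le_of_ne hsub ?_, ?_, ?_⟩, hne' _ (by simp)⟩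
    · rintro rfl
      by_cases hw : w ∈ u
      · exact hne (Finset.insert_erase hw).symm
      · rw [Finset.erase_eq_of_notMem hw] at hsu
        exact ssubset_irrefl _ hsu
    · exact fun v hv => huW v (Finset.mem_of_mem_erase hv)
    · exact fun v hv v' hv' =>
        huc v (Finset.mem_of_mem_erase hv) v' (Finset.mem_of_mem_erase hv')
  · convert h using 1
    ext u
    simp only [Finset.erase_eq_self]
    constructor
    · rintro ⟨⟨⟨hsu, huW, huc⟩, -⟩, hwu⟩
      exact ⟨hsu, fun v hv hvs => ⟨huW v hv hvs, fun h => hwu (h ▸ hv)⟩, huc⟩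
    · rintro ⟨hsu, huW, huc⟩
      have hwu : w ∉ u := fun hw => (huW w hw hws).2 rfl
      exact ⟨⟨⟨hsu, fun v hv hvs => (huW v hv hvs).1, huc⟩, hne' u hwu⟩, hwu⟩

/-- The part of a barycentric refinement above one of its vertices `t` is the refinement of the
link of `t`. -/
theorem cliqueExtensions_inter_neighborSet {s t : Finset V} {W : Set V}
    (ht : t ∈ cliqueExtensions G s W) :
    cliqueExtensions G s W ∩ (compGraph (Finset V)).neighborSet t =
      openInterval s t ∪
        cliqueExtensions G t {v ∈ W | v ∉ s ∧ ∀ a ∈ t, a ∉ s → G.Adj a v} := by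
  ext u
  constructor
  · rintro ⟨⟨hsu, huW, huc⟩, htu | hut⟩
    · have hs (v : V) (hv : v ∉ t) : v ∉ s := fun h => hv (ht.1.1 h)
      refine Or.inr ⟨htu, fun v hv hvt => ⟨huW v hv (hs v hvt), hs v hvt, fun a ha has => ?_⟩,
        fun v hv v' hv' h h' => huc v hv v' hv' (hs v h) (hs v' h')⟩
      exact huc a (htu.1 ha) v hv has (hs v hvt) fun h => hvt (h ▸ ha)
    · exact Or.inl ⟨hsu, hut⟩
  · rintro (⟨hsu, hut⟩ | ⟨htu, huW, huc⟩)
    · exact ⟨⟨hsu, fun v hv => ht.2.1 v (hut.1 hv),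
        fun v hv v' hv' => ht.2.2 v (hut.1 hv) v' (hut.1 hv')⟩, Or.inr hut⟩
    · refine ⟨⟨ht.1.trans htu, fun v hv hvs => ?_, fun v hv v' hv' hvs hvs' hne => ?_⟩,
        Or.inl htu⟩
      · by_cases hvt : v ∈ t
        · exact ht.2.1 v hvt hvs
        · exact (huW v hv hvt).1
      · by_cases hvt : v ∈ t <;> by_cases hvt' : v' ∈ t
        · exact ht.2.2 v hvt v' hvt' hvs hvs' hne
        · exact (huW v' hv' hvt').2.2 v hvt hvs
        · exact ((huW v hv hvt).2.2 v' hvt' hvs').symm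
        · exact huc v hv v' hv' hvt hvt' hne

theorem insert_mem_cliqueExtensions [DecidableEq V] {s : Finset V} {W : Set V} {w : V}
    (hw : w ∈ W) (hws : w ∉ s) : insert w s ∈ cliqueExtensions G s W := by
  refine ⟨Finset.ssubset_insert hws, ?_, ?_⟩
  · rintro v hv hvs
    rwa [Finset.eq_of_mem_insert_of_notMem hv hvs]
  · rintro v hv v' hv' hvs hvs' hne
    exact absurd ((Finset.eq_of_mem_insert_of_notMem hv hvs).trans
      (Finset.eq_of_mem_insert_of_notMem hv' hvs').symm) hne

/-- The barycentric refinement of a contractible graph is contractible. The vertex `s ∪ {w}` of the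
refinement can be removed first, since only simplices of the link of `w` lie above it; the operator
`u ↦ u \ {w}` then retracts what is left to the refinement of `W \ {w}`. -/
theorem ContractibleOn.cliqueExtensions {W : Set V} (hW : ContractibleOn G W) {s : Finset V}
    (hs : ∀ v ∈ s, v ∉ W) :
    ContractibleOn (compGraph (Finset V)) (cliqueExtensions G s W) := by
  classical
  induction hW generalizing s with
  | point w =>
    have hws : w ∉ s := fun h => hs w h rfl
    convert ContractibleOn.point (G := compGraph (Finset V)) (insert w s) using 1
    ext u
    constructor
    · rintro ⟨hsu, huW, -⟩
      obtain ⟨v, hv, hvs⟩ := Finset.exists_of_ssubset hsu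
      refine Finset.Subset.antisymm (fun v hv => ?_) ?_
      · by_cases h : v ∈ s
        · exact Finset.mem_insert_of_mem h
        · rw [huW v hv h]; exact Finset.mem_insert_self w s
      · refine Finset.insert_subset ?_ hsu.1
        rwa [← huW v hv hvs]
    · rintro rfl
      exact insert_mem_cliqueExtensions rfl hws
  | step W w hw hWs hWp ihs ihp =>
    have hws : w ∉ s := fun h => hs w h hw
    have hmem : insert w s ∈ GeomGraph.cliqueExtensions G s W :=
      insert_mem_cliqueExtensions hw hws
    refine .step _ (insert w s) hmem ?_ ?_
    · have hempty : openInterval s (insert w s) = ∅ := by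
        refine Set.eq_empty_of_forall_notMem fun u hu => ?_
        have h1 := Finset.card_lt_card hu.1
        have h2 := Finset.card_lt_card hu.2
        rw [Finset.card_insert_of_notMem hws] at h2
        omega
      have hlink : {v ∈ W | v ∉ s ∧ ∀ a ∈ insert w s, a ∉ s → G.Adj a v} =
          W ∩ G.neighborSet w := by
        ext v
        constructor
        · exact fun h => ⟨h.1, h.2.2 w (Finset.mem_insert_self w s) hws⟩
        · refine fun h => ⟨h.1, fun h' => hs v h' h.1, fun a ha has => ?_⟩
          rw [Finset.eq_of_mem_insert_of_notMem ha has]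
          exact h.2
      rw [cliqueExtensions_inter_neighborSet hmem, hempty, Set.empty_union, hlink]
      refine ihs fun v hv hvW => ?_
      rcases Finset.mem_insert.1 hv with rfl | hv
      · exact G.loopless.irrefl _ hvW.2
      · exact hs v hv hvW.1
    · exact contractibleOn_cliqueExtensions_diff
        (ContractibleOn.step W w hw hWs hWp).finite hws
        (ihp fun v hv h => hs v hv h.1)

/-- The barycentric refinement of a `d`-sphere is a `d`-sphere. -/
theorem IsSphereOn.cliqueExtensions {d : ℤ} {W : Set V} (hW : IsSphereOn G d W) {s : Finset V}
    (hs : ∀ v ∈ s, v ∉ W) :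
    IsSphereOn (compGraph (Finset V)) d (cliqueExtensions G s W) := by
  classical
  induction hn : (d + 1).toNat using Nat.strong_induction_on generalizing d W s with
  | _ n ih =>
    subst hn
    cases hW with
    | empty =>
      convert IsSphereOn.empty using 1
      refine Set.eq_empty_of_forall_notMem fun u hu => ?_
      obtain ⟨v, hv, hvs⟩ := Finset.exists_of_ssubset hu.1
      exact hu.2.1 v hv hvs
    | step _ hd _ hWs hWp =>
      have hW := IsSphereOn.step d hd W hWs hWp
      refine .step d hd _ ?_ ?_
      · intro t ht
        have hst := Finset.card_lt_card ht.1
        have hlink : IsSphereOn G (d - (t \ s).card)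
            {v ∈ W | v ∉ s ∧ ∀ a ∈ t, a ∉ s → G.Adj a v} := by
          convert hW.link (t \ s) ?_ ?_ using 1
          · ext v
            constructor
            · exact fun h => ⟨h.1, fun a ha =>
                h.2.2 a (Finset.mem_sdiff.1 ha).1 (Finset.mem_sdiff.1 ha).2⟩
            · exact fun h => ⟨h.1, fun h' => hs v h' h.1, fun a ha has =>
                h.2 a (Finset.mem_sdiff.2 ⟨ha, has⟩)⟩
          · intro v hv v' hv' hne
            have hv := Finset.mem_sdiff.1 hv
            have hv' := Finset.mem_sdiff.1 hv'
            exact ht.2.2 v hv.1 v' hv'.1 hv.2 hv'.2 hne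
          · intro v hv
            have hv := Finset.mem_sdiff.1 hv
            exact ht.2.1 v hv.1 hv.2
        have hcard := Finset.card_sdiff_add_card_eq_card ht.1.1
        rw [cliqueExtensions_inter_neighborSet ht]
        convert (isSphereOn_openInterval ht.1).join
          (ih _ (by omega) hlink (s := t) ?_ rfl) ?_ using 1
        · rw [← hcard]; push_cast; ring
        · rintro v hvt ⟨hvW, hvs, h⟩
          exact G.loopless.irrefl _ (h v hvt hvs)
        · exact fun a ha b hb => Or.inl (ha.2.trans hb.1)
      · obtain ⟨w, hw, hWw⟩ := hWp
        have hws : w ∉ s := fun h => hs w h hw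
        exact ⟨insert w s, insert_mem_cliqueExtensions hw hws,
          contractibleOn_cliqueExtensions_diff hW.finite hws
            (hWw.cliqueExtensions fun v hv h => hs v hv h.1)⟩

end Refinement

/-! ### Subsets meeting both sides of a partition -/

section Mixed

variable {V : Type u}

/-- The proper subsets of `s` that meet both `A` and the complement of `A`. -/
def mixedBelow (A : Set V) (s : Finset V) : Set (Finset V) :=
  {u | u ⊂ s ∧ (∃ a ∈ u, a ∈ A) ∧ ∃ b ∈ u, b ∉ A}

theorem mixedBelow_compl (A : Set V) (s : Finset V) : mixedBelow Aᶜ s = mixedBelow A s := by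
  ext u
  simp only [mixedBelow, Set.mem_compl_iff, not_not]
  exact and_congr_right fun _ => and_comm

theorem mixedBelow_finite (A : Set V) (s : Finset V) : (mixedBelow A s).Finite :=
  (finite_setOf_ssubset s).subset fun _ h => h.1

/-- If `s ∩ A` has a second element besides `w`, removing the facet `s \ {w}` from the mixed proper
subsets of `s` leaves a contractible poset: `u ↦ u ∪ {w}` and then `u ↦ {w} ∪ (u \ A)` retract it
to the sets `{w} ∪ q` with `q ⊆ s \ A` non-empty, which have a greatest element. -/
theorem contractibleOn_mixedBelow_diff [DecidableEq V] {A : Set V} {s : Finset V} {w p b : V}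
    (hws : w ∈ s) (hwA : w ∈ A) (hps : p ∈ s) (hpA : p ∈ A) (hpw : p ≠ w) (hbs : b ∈ s)
    (hbA : b ∉ A) :
    ContractibleOn (compGraph (Finset V)) (mixedBelow A s \ {s.erase w}) := by
  classical
  have hfin := (mixedBelow_finite A s).subset
    (Set.sdiff_subset (s := mixedBelow A s) (t := {s.erase w}))
  have hne (u : Finset V) (hu : w ∈ u) : u ≠ s.erase w := by
    rintro rfl; simp at hu
  refine contractibleOn_of_closure hfin (fun u => insert w u) ?_
    (fun u _ => Finset.subset_insert w u) (fun u _ v _ huv => Finset.insert_subset_insert w huv)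
    (fun u _ => by simp) ?_
  · rintro u ⟨⟨hus, -, b', hb', hb'A⟩, hu⟩
    refine ⟨⟨lt_of_le_of_ne (Finset.insert_subset hws hus.1) ?_,
      ⟨w, Finset.mem_insert_self w u, hwA⟩, b', Finset.mem_insert_of_mem hb', hb'A⟩,
      hne _ (Finset.mem_insert_self w u)⟩
    rintro rfl
    by_cases hw : w ∈ u
    · rw [Finset.insert_eq_of_mem hw] at hus
      exact ssubset_irrefl _ hus
    · exact hu (Finset.erase_insert hw).symm
  have hfin' := hfin.subset
    (Set.sep_subset (mixedBelow A s \ {s.erase w}) fun u => insert w u = u)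
  have hφ (u : Finset V) (hu : w ∈ u) : insert w (u.filter (· ∉ A)) ⊆ u :=
    Finset.insert_subset hu (Finset.filter_subset _ u)
  have hfix (u : Finset V) : insert w (insert w u) = insert w u := by simp
  refine contractibleOn_of_interior hfin' (fun u => insert w (u.filter (· ∉ A))) ?_
    (fun u hu => hφ u (Finset.insert_eq_self.1 hu.2)) (fun u _ v _ huv =>
      Finset.insert_subset_insert w (Finset.filter_subset_filter _ huv)) ?_ ?_
  · rintro u ⟨⟨⟨hus, -, b', hb', hb'A⟩, -⟩, hu⟩
    refine ⟨⟨⟨lt_of_le_of_lt (hφ u (Finset.insert_eq_self.1 hu)) hus,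
      ⟨w, Finset.mem_insert_self w _, hwA⟩, b', ?_, hb'A⟩,
      hne _ (Finset.mem_insert_self w _)⟩, hfix _⟩
    exact Finset.mem_insert_of_mem (Finset.mem_filter.2 ⟨hb', hb'A⟩)
  · intro u _
    simp [Finset.filter_insert, hwA, Finset.filter_filter]
  · refine contractibleOn_of_cone (hfin'.subset (Set.sep_subset _ _))
      (a := insert w (s.filter (· ∉ A))) ?_ ?_
    · refine ⟨⟨⟨⟨lt_of_le_of_ne (hφ s hws) ?_, ⟨w, Finset.mem_insert_self w _, hwA⟩, b, ?_,
        hbA⟩, hne _ (Finset.mem_insert_self w _)⟩, hfix _⟩, ?_⟩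
      · intro h
        rw [← h] at hps
        simp [hpw, hpA] at hps
      · exact Finset.mem_insert_of_mem (Finset.mem_filter.2 ⟨hbs, hbA⟩)
      · simp [Finset.filter_insert, hwA, Finset.filter_filter]
    · rintro u ⟨⟨⟨⟨hus, -⟩, -⟩, -⟩, hu⟩ hne
      refine Or.inr (lt_of_le_of_ne ?_ hne)
      rw [← hu]
      exact Finset.insert_subset_insert w (Finset.filter_subset_filter _ hus.1)

/-- The mixed proper subsets of `s` form the barycentric refinement of the boundary of a product of
two simplices, a sphere of dimension `|s| - 3`. -/
theorem isSphereOn_mixedBelow {A : Set V} {s : Finset V} (ha : ∃ a ∈ s, a ∈ A)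
    (hb : ∃ b ∈ s, b ∉ A) :
    IsSphereOn (compGraph (Finset V)) ((s.card : ℤ) - 3) (mixedBelow A s) := by
  classical
  induction hn : s.card using Nat.strong_induction_on generalizing s with
  | _ n ih =>
    subst hn
    obtain ⟨a, has, haA⟩ := ha
    obtain ⟨b, hbs, hbA⟩ := hb
    have hab : a ≠ b := fun h => hbA (h ▸ haA)
    have hpair (x y : V) (hxy : x ≠ y) : ({x, y} : Finset V).card = 2 := Finset.card_pair hxy
    have htwo {u : Finset V} (h1 : ∃ a ∈ u, a ∈ A) (h2 : ∃ b ∈ u, b ∉ A) : 2 ≤ u.card := by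
      obtain ⟨x, hx, hxA⟩ := h1
      obtain ⟨y, hy, hyA⟩ := h2
      exact Finset.one_lt_card.2 ⟨x, hx, y, hy, fun h => hyA (h ▸ hxA)⟩
    have hs2 := htwo ⟨a, has, haA⟩ ⟨b, hbs, hbA⟩
    rcases hs2.eq_or_lt with h2 | h3
    · convert IsSphereOn.empty using 1
      · rw [← h2]; norm_num
      · refine Set.eq_empty_of_forall_notMem fun u hu => ?_
        have := htwo hu.2.1 hu.2.2
        have := Finset.card_lt_card hu.1
        omega
    refine .step _ (by omega) _ ?_ ?_
    · intro u hu
      have hlt := Finset.card_lt_card hu.1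
      have : mixedBelow A s ∩ (compGraph (Finset V)).neighborSet u =
          mixedBelow A u ∪ openInterval u s := by
        ext v
        constructor
        · rintro ⟨hv, h | h⟩
          · exact Or.inr ⟨h, hv.1⟩
          · exact Or.inl ⟨h, hv.2⟩
        · rintro (h | h)
          · exact ⟨⟨h.1.trans hu.1, h.2⟩, Or.inr h.1⟩
          · obtain ⟨-, ⟨a', ha', ha'A⟩, b', hb', hb'A⟩ := hu
            exact ⟨⟨h.2, ⟨a', h.1.1 ha', ha'A⟩, b', h.1.1 hb', hb'A⟩, Or.inl h.1⟩
      rw [this]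
      convert (ih _ hlt hu.2.1 hu.2.2 rfl).join (isSphereOn_openInterval hu.1) ?_ using 1
      · ring
      · exact fun a ha b hb => Or.inl (ha.1.trans hb.1)
    -- One of the two sides has a second element `c`; the facet to remove is opposite to the other
    -- element of that side.
    · obtain ⟨c, hcs, hc⟩ : ∃ c ∈ s, c ∉ ({a, b} : Finset V) :=
        Finset.exists_mem_notMem_of_card_lt_card (by rw [hpair a b hab]; exact h3)
      simp only [Finset.mem_insert, Finset.mem_singleton, not_or] at hc
      have hfacet {x y z : V} (hx : x ∈ s) (hz : z ∈ s) (hzx : z ≠ x) (hy : y ∈ s) (hyx : y ≠ x)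
          (hzA : z ∈ A) (hyA : y ∉ A) : s.erase x ∈ mixedBelow A s :=
        ⟨Finset.erase_ssubset hx, ⟨z, Finset.mem_erase.2 ⟨hzx, hz⟩, hzA⟩,
          y, Finset.mem_erase.2 ⟨hyx, hy⟩, hyA⟩
      by_cases hcA : c ∈ A
      · exact ⟨s.erase a, hfacet has hcs hc.1 hbs hab.symm hcA hbA,
          contractibleOn_mixedBelow_diff has haA hcs hcA hc.1 hbs hbA⟩
      · refine ⟨s.erase b, hfacet hbs has hab hcs hc.2 haA hcA, ?_⟩
        rw [← mixedBelow_compl]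
        exact contractibleOn_mixedBelow_diff hbs hbA hcs hcA hc.2 has (not_not.2 haA)

end Mixed

/-! ### Euler characteristics -/

section Euler

variable {V W : Type u} {G : SimpleGraph V} {H : SimpleGraph W} {F : Set V}

/-- The cliques of `G` inside `F`, the empty one included. -/
def cliquesOn (G : SimpleGraph V) (F : Set V) : Set (Finset V) :=
  {s | (s : Set V) ⊆ F ∧ G.IsClique (s : Set V)}

/-- The sum of `(-1) ^ |s|` over the cliques `s` inside `F`, the empty one included. It equals
`1 - χ` and satisfies a simpler recursion than the Euler characteristic `χ`. -/
noncomputable def signedCliqueCount (G : SimpleGraph V) (F : Set V) : ℤ :=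
  ∑ᶠ s ∈ cliquesOn G F, (-1 : ℤ) ^ s.card

theorem cliquesOn_finite (G : SimpleGraph V) (hF : F.Finite) : (cliquesOn G F).Finite := by
  refine (Finset.finite_toSet hF.toFinset.powerset).subset fun s hs => ?_
  simpa using hs.1

theorem empty_mem_cliquesOn : ∅ ∈ cliquesOn G F := by simp [cliquesOn]

theorem signedCliqueCount_empty : signedCliqueCount G ∅ = 1 := by
  have : cliquesOn G ∅ = {∅} := by
    ext s
    simp only [cliquesOn, Set.subset_empty_iff, Finset.coe_eq_empty, Set.mem_ofPred_eq,
      Set.mem_singleton_iff, and_iff_left_iff_imp]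
    rintro rfl
    simp
  rw [signedCliqueCount, this, finsum_mem_singleton]
  simp

theorem eulerChar_eq_one_sub (e : H ↪g G) (hfin : (Set.range e).Finite) :
    eulerChar H = 1 - signedCliqueCount G (Set.range e) := by
  classical
  let φ : Simplex H → Finset V := fun s => s.1.map e.toEmbedding
  have hφ : Function.Injective φ := fun s t h => Subtype.ext (Finset.map_injective _ h)
  have hcard (s : Simplex H) : (φ s).card = s.1.card := Finset.card_map _
  have hrange : cliquesOn G (Set.range e) = insert ∅ (Set.range φ) := by
    ext t
    constructor
    · rintro ⟨ht, hc⟩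
      rcases t.eq_empty_or_nonempty with rfl | hne
      · exact Or.inl rfl
      · refine Or.inr ?_
        obtain ⟨s, rfl⟩ : ∃ s : Finset W, s.map e.toEmbedding = t := by
          refine ⟨t.preimage e e.injective.injOn, ?_⟩
          rw [Finset.map_eq_image]
          exact Finset.image_preimage_of_bij e t ⟨fun _ h => h, e.injective.injOn, fun v hv => by
            obtain ⟨w, rfl⟩ := ht hv
            exact ⟨w, hv, rfl⟩⟩
        refine ⟨⟨s, by simpa using hne, fun v hv w hw hvw => ?_⟩, rfl⟩
        refine e.map_adj_iff.1 (hc ?_ ?_ (e.injective.ne hvw))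
        · exact Finset.mem_coe.2 (Finset.mem_map_of_mem e.toEmbedding hv)
        · exact Finset.mem_coe.2 (Finset.mem_map_of_mem e.toEmbedding hw)
    · rintro (rfl | ⟨s, rfl⟩)
      · exact empty_mem_cliquesOn
      · constructor
        · rintro v hv
          obtain ⟨w, -, rfl⟩ := Finset.mem_map.1 (Finset.mem_coe.1 hv)
          exact ⟨w, rfl⟩
        · intro v hv v' hv' hne
          obtain ⟨w, hw, rfl⟩ := Finset.mem_map.1 (Finset.mem_coe.1 hv)
          obtain ⟨w', hw', rfl⟩ := Finset.mem_map.1 (Finset.mem_coe.1 hv')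
          exact e.map_adj_iff.2 (s.2.2 hw hw' fun h => hne (congrArg e h))
  have hnot : ∅ ∉ Set.range φ := by
    rintro ⟨s, hs⟩
    exact s.2.1.ne_empty (Finset.map_eq_empty.1 hs)
  have hφfin : (Set.range φ).Finite :=
    (cliquesOn_finite G hfin).subset (hrange ▸ Set.subset_insert _ _)
  rw [signedCliqueCount, hrange, finsum_mem_insert _ hnot hφfin, finsum_mem_range hφ, eulerChar]
  have hsign : (fun s : Simplex H => (-1 : ℤ) ^ (φ s).card) =
      fun s => -(-1 : ℤ) ^ (s.1.card - 1) := by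
    funext s
    obtain ⟨k, hk⟩ := Nat.exists_eq_add_of_le' s.2.1.card_pos
    rw [hcard, hk, Nat.add_sub_cancel, pow_succ]
    ring
  rw [hsign, finsum_neg_distrib]
  simp

theorem signedCliqueCount_eq_sub (hF : F.Finite) {x : V} (hx : x ∈ F) :
    signedCliqueCount G F =
      signedCliqueCount G (F \ {x}) - signedCliqueCount G (F ∩ G.neighborSet x) := by
  classical
  have hxN (s : Finset V) (hs : s ∈ cliquesOn G (F ∩ G.neighborSet x)) : x ∉ s :=
    fun h => G.loopless.irrefl _ (hs.1 h).2
  have hsplit : cliquesOn G F =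
      cliquesOn G (F \ {x}) ∪ (insert x) '' cliquesOn G (F ∩ G.neighborSet x) := by
    ext s
    constructor
    · rintro ⟨hs, hc⟩
      by_cases hxs : x ∈ s
      · refine Or.inr ⟨s.erase x, ⟨fun v hv => ?_, hc.subset (by simp)⟩, Finset.insert_erase hxs⟩
        have hv := Finset.mem_erase.1 (Finset.mem_coe.1 hv)
        exact ⟨hs hv.2, hc hxs hv.2 hv.1.symm⟩
      · exact Or.inl ⟨fun v hv => ⟨hs hv, fun h => hxs (Set.mem_singleton_iff.1 h ▸ hv)⟩, hc⟩
    · rintro (⟨hs, hc⟩ | ⟨s, ⟨hs, hc⟩, rfl⟩)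
      · exact ⟨hs.trans Set.sdiff_subset, hc⟩
      · constructor
        · rw [Finset.coe_insert]
          exact Set.insert_subset hx (hs.trans Set.inter_subset_left)
        · rw [Finset.coe_insert]
          exact hc.insert fun v hv _ => (hs hv).2
  have hdisj : Disjoint (cliquesOn G (F \ {x}))
      ((insert x) '' cliquesOn G (F ∩ G.neighborSet x)) := by
    rw [Set.disjoint_right]
    rintro _ ⟨s, -, rfl⟩ h
    exact (h.1 (Finset.mem_coe.2 (Finset.mem_insert_self x s))).2 rfl
  have hinj : Set.InjOn (insert x) (cliquesOn G (F ∩ G.neighborSet x)) := by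
    intro s hs t ht h
    rw [← Finset.erase_insert (hxN s hs), ← Finset.erase_insert (hxN t ht)]
    exact congrArg (fun u => u.erase x) h
  rw [signedCliqueCount, hsplit, finsum_mem_union hdisj
    (cliquesOn_finite G (hF.subset Set.sdiff_subset))
    ((cliquesOn_finite G (hF.subset Set.inter_subset_left)).image _), finsum_mem_image hinj]
  have : ∑ᶠ s ∈ cliquesOn G (F ∩ G.neighborSet x), (-1 : ℤ) ^ (insert x s).card =
      ∑ᶠ s ∈ cliquesOn G (F ∩ G.neighborSet x), -(-1 : ℤ) ^ s.card := by
    refine finsum_mem_congr rfl fun s hs => ?_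
    rw [Finset.card_insert_of_notMem (hxN s hs), pow_succ]
    ring
  rw [this, finsum_mem_neg_distrib _ (cliquesOn_finite G (hF.subset Set.inter_subset_left)),
    ← sub_eq_add_neg]
  rfl

theorem ContractibleOn.signedCliqueCount_eq_zero (h : ContractibleOn G F) :
    signedCliqueCount G F = 0 := by
  induction h with
  | point x =>
    have : ({x} : Set V) ∩ G.neighborSet x = ∅ := by
      ext v
      simp only [Set.mem_inter_iff, Set.mem_singleton_iff, SimpleGraph.mem_neighborSet,
        Set.mem_empty_iff_false, iff_false, not_and]
      rintro rfl
      exact G.loopless.irrefl _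
    rw [signedCliqueCount_eq_sub (Set.finite_singleton x) (Set.mem_singleton x), this,
      Set.sdiff_self, signedCliqueCount_empty, sub_self]
  | step F x hx hs hp ihs ihp =>
    rw [signedCliqueCount_eq_sub (ContractibleOn.step F x hx hs hp).finite hx, ihs, ihp, sub_self]

/-- A `d`-sphere has Euler characteristic `1 + (-1) ^ d`. -/
theorem IsSphereOn.signedCliqueCount_eq {d : ℤ} (h : IsSphereOn G d F) :
    signedCliqueCount G F = ((d + 1).negOnePow : ℤ) := by
  induction h with
  | empty => simp [signedCliqueCount_empty]
  | step d hd F hs hp ih =>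
    have hfin := (IsSphereOn.step d hd F hs hp).finite
    obtain ⟨x, hx, hxF⟩ := hp
    rw [signedCliqueCount_eq_sub hfin hx, hxF.signedCliqueCount_eq_zero, ih x hx,
      sub_add_cancel, Int.negOnePow_succ]
    simp

/-- The Euler characteristic of the comparability graph of a finite poset is the sum of the indices
`1 - χ` of the parts below its elements. -/
theorem signedCliqueCount_compGraph {α : Type u} [PartialOrder α] {M : Set α} (hM : M.Finite) :
    signedCliqueCount (compGraph α) M =
      1 - ∑ᶠ s ∈ M, signedCliqueCount (compGraph α) (M ∩ Set.Iio s) := by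
  induction hn : M.ncard using Nat.strong_induction_on generalizing M with
  | _ n ih =>
    subst hn
    rcases M.eq_empty_or_nonempty with rfl | hne
    · simp [signedCliqueCount_empty]
    obtain ⟨u, huM, hmax⟩ := hM.exists_maximal hne
    have hmax' {v : α} (hv : v ∈ M) : ¬ u < v := fun h => (hmax hv h.le).not_gt h
    have hlink : M ∩ (compGraph α).neighborSet u = M ∩ Set.Iio u := by
      ext v
      exact and_congr_right fun hv => ⟨fun h => h.resolve_left (hmax' hv), Or.inr⟩
    have hlow : ∑ᶠ s ∈ M \ {u}, signedCliqueCount (compGraph α) ((M \ {u}) ∩ Set.Iio s) =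
        ∑ᶠ s ∈ M \ {u}, signedCliqueCount (compGraph α) (M ∩ Set.Iio s) := by
      refine finsum_mem_congr rfl fun s hs => congrArg _ ?_
      ext v
      refine ⟨fun h => ⟨h.1.1, h.2⟩, fun h => ⟨⟨h.1, fun hvu => hmax' hs.1 ?_⟩, h.2⟩⟩
      exact Set.mem_singleton_iff.1 hvu ▸ h.2
    have hsum := finsum_mem_insert (fun s => signedCliqueCount (compGraph α) (M ∩ Set.Iio s))
      (s := M \ {u}) (a := u) (by simp) (hM.subset Set.sdiff_subset)
    rw [Set.insert_sdiff_singleton, Set.insert_eq_of_mem huM] at hsum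
    rw [signedCliqueCount_eq_sub hM huM, hlink,
      ih _ (Set.ncard_sdiff_singleton_lt_of_mem huM hM) (hM.subset Set.sdiff_subset) rfl, hlow,
      hsum]
    ring

end Euler

/-! ### The cliques on which a function changes sign -/

section MixedCliques

variable {V : Type u} {G : SimpleGraph V} {A : Set V}

/-- The cliques of `G` that meet both `A` and the complement of `A`. -/
def mixedCliques (G : SimpleGraph V) (A : Set V) : Set (Finset V) :=
  {s | G.IsClique (s : Set V) ∧ (∃ a ∈ s, a ∈ A) ∧ ∃ b ∈ s, b ∉ A}

theorem mixedCliques_inter_Iio {s : Finset V} (hs : s ∈ mixedCliques G A) :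
    mixedCliques G A ∩ Set.Iio s = mixedBelow A s := by
  ext u
  exact ⟨fun h => ⟨h.2, h.1.2⟩, fun h => ⟨⟨hs.1.subset (Finset.coe_subset.2 h.1.1), h.2⟩, h.1⟩⟩

/-- The unit sphere of `s` in the poset of mixed cliques is the join of the mixed proper subsets of
`s` with the refined link of `s`. -/
theorem isSphereOn_mixedCliques_inter_neighborSet {k : ℤ} (hG : IsSphereOn G k Set.univ)
    {s : Finset V} (hs : s ∈ mixedCliques G A) :
    IsSphereOn (compGraph (Finset V)) (k - 2)
      (mixedCliques G A ∩ (compGraph (Finset V)).neighborSet s) := by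
  have hsplit : mixedCliques G A ∩ (compGraph (Finset V)).neighborSet s =
      mixedBelow A s ∪ cliqueExtensions G s {v ∈ Set.univ | ∀ a ∈ s, G.Adj a v} := by
    ext u
    constructor
    · rintro ⟨hu, h | h⟩
      · refine Or.inr ⟨h, fun v hv hvs => ⟨trivial, fun a ha => ?_⟩,
          fun v hv v' hv' _ _ hne => hu.1 hv hv' hne⟩
        exact hu.1 (h.1 ha) hv fun h => hvs (h ▸ ha)
      · exact Or.inl ⟨h, hu.2⟩
    · rintro (h | ⟨hsu, hlink, hc⟩)
      · exact ⟨⟨hs.1.subset (Finset.coe_subset.2 h.1.1), h.2⟩, Or.inr h.1⟩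
      · obtain ⟨hsc, ⟨a, ha, haA⟩, b, hb, hbA⟩ := hs
        refine ⟨⟨fun v hv v' hv' hne => ?_, ⟨a, hsu.1 ha, haA⟩, b, hsu.1 hb, hbA⟩, Or.inl hsu⟩
        by_cases hvs : v ∈ s <;> by_cases hvs' : v' ∈ s
        · exact hsc hvs hvs' hne
        · exact (hlink v' hv' hvs').2 v hvs
        · exact ((hlink v hv hvs).2 v' hvs').symm
        · exact hc v hv v' hv' hvs hvs' hne
  have hlink := (hG.link s hs.1 (Set.subset_univ _)).cliqueExtensions (s := s)
    fun v hv h => G.loopless.irrefl _ (h.2 v hv)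
  rw [hsplit]
  convert (isSphereOn_mixedBelow hs.2.1 hs.2.2).join hlink ?_ using 1
  · ring
  · exact fun a ha b hb => Or.inl (ha.1.trans hb.1)

/-- The part of the poset of mixed cliques below `s` is a `(|s| - 3)`-sphere, so `s` has index
`(-1) ^ |s|`. -/
theorem signedCliqueCount_mixedCliques [Finite V] :
    signedCliqueCount (compGraph (Finset V)) (mixedCliques G A) =
      1 - ∑ᶠ s ∈ mixedCliques G A, (-1 : ℤ) ^ s.card := by
  rw [signedCliqueCount_compGraph (Set.toFinite _)]
  refine congrArg _ (finsum_mem_congr rfl fun s hs => ?_)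
  rw [mixedCliques_inter_Iio hs, (isSphereOn_mixedBelow hs.2.1 hs.2.2).signedCliqueCount_eq,
    show (s.card : ℤ) - 3 + 1 = s.card - 2 by ring, Int.negOnePow_sub,
    Int.negOnePow_even 2 (by decide), mul_one]
  simp [Int.negOnePow_def]

theorem signedCliqueCount_univ_eq [Finite V] :
    signedCliqueCount G Set.univ = signedCliqueCount G A + signedCliqueCount G Aᶜ - 1 +
      ∑ᶠ s ∈ mixedCliques G A, (-1 : ℤ) ^ s.card := by
  have hunion : cliquesOn G Set.univ = (cliquesOn G A ∪ cliquesOn G Aᶜ) ∪ mixedCliques G A := by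
    ext s
    constructor
    · rintro ⟨-, hc⟩
      by_cases h1 : (s : Set V) ⊆ A
      · exact Or.inl (Or.inl ⟨h1, hc⟩)
      by_cases h2 : (s : Set V) ⊆ Aᶜ
      · exact Or.inl (Or.inr ⟨h2, hc⟩)
      obtain ⟨b, hb, hbA⟩ := Set.not_subset.1 h1
      obtain ⟨a, ha, haA⟩ := Set.not_subset.1 h2
      exact Or.inr ⟨hc, ⟨a, ha, not_not.1 haA⟩, b, hb, hbA⟩
    · rintro ((h | h) | h)
      · exact ⟨Set.subset_univ _, h.2⟩
      · exact ⟨Set.subset_univ _, h.2⟩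
      · exact ⟨Set.subset_univ _, h.1⟩
  have hdisj : Disjoint (cliquesOn G A ∪ cliquesOn G Aᶜ) (mixedCliques G A) := by
    rw [Set.disjoint_right]
    rintro s ⟨-, ⟨a, ha, haA⟩, b, hb, hbA⟩ (h | h)
    · exact hbA (h.1 hb)
    · exact h.1 ha haA
  have hinter : cliquesOn G A ∩ cliquesOn G Aᶜ = {∅} := by
    ext s
    constructor
    · rintro ⟨h1, h2⟩
      exact Finset.eq_empty_of_forall_notMem fun v hv => h2.1 hv (h1.1 hv)
    · rintro rfl
      exact ⟨empty_mem_cliquesOn, empty_mem_cliquesOn⟩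
  have h := finsum_mem_union_inter (f := fun s : Finset V => (-1 : ℤ) ^ s.card)
    (Set.toFinite (cliquesOn G A)) (Set.toFinite (cliquesOn G Aᶜ))
  rw [hinter, finsum_mem_singleton, Finset.card_empty, pow_zero] at h
  rw [signedCliqueCount, hunion, finsum_mem_union hdisj (Set.toFinite _) (Set.toFinite _),
    eq_sub_of_add_eq h]
  rfl

end MixedCliques

/-! ### Central surfaces -/

section CentralSurface

variable {V : Type u} {G : SimpleGraph V} {f : V → ℝ} {x : V}

/-- The inclusion of `S⁻_f(x)` into `S(x)`. -/
def lowerSphereEmbedding (G : SimpleGraph V) (f : V → ℝ) (x : V) :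
    lowerSphere G f x ↪g unitSphere G x where
  toFun y := ⟨y.1, y.2.1⟩
  inj' _ _ h := Subtype.ext (congrArg (fun z : G.neighborSet x => z.1) h)
  map_rel_iff' := Iff.rfl

theorem range_lowerSphereEmbedding :
    Set.range (lowerSphereEmbedding G f x) = {y : G.neighborSet x | f y.1 < f x} := by
  ext y
  constructor
  · rintro ⟨z, rfl⟩
    exact z.2.2
  · exact fun h => ⟨⟨y.1, y.2, h⟩, rfl⟩

theorem index_eq_signedCliqueCount [Finite V] :
    index G f x = signedCliqueCount (unitSphere G x) {y : G.neighborSet x | f y.1 < f x} := by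
  rw [index, eulerChar_eq_one_sub (lowerSphereEmbedding G f x) (Set.toFinite _),
    range_lowerSphereEmbedding, sub_sub_cancel]

/-- The central surface as part of the poset of finite sets of neighbours. -/
def centralSurfaceEmbedding (G : SimpleGraph V) (f : V → ℝ) (x : V) :
    centralSurface G f x ↪g compGraph (Finset (G.neighborSet x)) where
  toFun s := s.1.1
  inj' _ _ h := Subtype.ext (Subtype.ext h)
  map_rel_iff' := Iff.rfl

theorem LocallyInjective.not_mem_lower_iff (hf : LocallyInjective G f) (y : G.neighborSet x) :
    y ∉ {y : G.neighborSet x | f y.1 < f x} ↔ f x < f y.1 :=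
  ⟨fun h => lt_of_le_of_ne (not_lt.1 h) (hf x y y.2), fun h => not_lt.2 h.le⟩

theorem range_centralSurfaceEmbedding (hf : LocallyInjective G f) :
    Set.range (centralSurfaceEmbedding G f x) =
      mixedCliques (unitSphere G x) {y : G.neighborSet x | f y.1 < f x} := by
  ext s
  constructor
  · rintro ⟨⟨⟨s, hs, hc⟩, ha, b, hb, hbx⟩, rfl⟩
    exact ⟨hc, ha, b, hb, (hf.not_mem_lower_iff b).2 hbx⟩
  · rintro ⟨hc, ⟨a, ha, hax⟩, b, hb, hbx⟩
    exact ⟨⟨⟨s, ⟨a, ha⟩, hc⟩, ⟨a, ha, hax⟩, b, hb, (hf.not_mem_lower_iff b).1 hbx⟩, rfl⟩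

theorem IsDGraph.isSphereOn_univ {d : ℤ} (hG : IsDGraph d G) (x : V) :
    IsSphereOn (unitSphere G x) (d - 1) Set.univ := by
  have h := (hG.2 x).isSphereOn_range (SimpleGraph.Embedding.refl (G := unitSphere G x))
  rwa [show Set.range (SimpleGraph.Embedding.refl (G := unitSphere G x)) = Set.univ from
    Set.range_id] at h

theorem IsDGraph.centralSurface {d : ℤ} (hG : IsDGraph d G) (hf : LocallyInjective G f) (x : V) :
    IsDGraph (d - 2) (centralSurface G f x) := by
  have := hG.1
  refine ⟨Finite.of_injective _ (centralSurfaceEmbedding G f x).injective, fun s => ?_⟩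
  have hS := hG.isSphereOn_univ x
  have hs : centralSurfaceEmbedding G f x s ∈
      mixedCliques (unitSphere G x) {y : G.neighborSet x | f y.1 < f x} := by
    rw [← range_centralSurfaceEmbedding hf]
    exact ⟨s, rfl⟩
  have h := isSphereOn_mixedCliques_inter_neighborSet hS hs
  rw [sub_right_comm]
  refine h.isSphere ((centralSurfaceEmbedding G f x).comp (unitSphereEmbedding _ s)) ?_
  rw [range_unitSphereEmbedding, range_centralSurfaceEmbedding hf]

/-- With `χ(S) = χ(S⁻) + χ(S⁺) - χ(B)` for the `(d - 1)`-sphere `S = S(x)`, where `B` is the central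
surface, the two indices add up to `2 - χ(S) - χ(B)`. -/
theorem IsDGraph.index_add_index_neg {d : ℤ} (hG : IsDGraph d G) (hf : LocallyInjective G f)
    (x : V) :
    index G f x + index G (-f) x =
      1 + (d.negOnePow : ℤ) - eulerChar (GeomGraph.centralSurface G f x) := by
  have := hG.1
  have hupper : {y : G.neighborSet x | (-f) y.1 < (-f) x} =
      {y : G.neighborSet x | f y.1 < f x}ᶜ := by
    ext y
    rw [Set.mem_compl_iff, hf.not_mem_lower_iff]
    exact neg_lt_neg_iff (a := f y.1) (b := f x)
  have hS := hG.isSphereOn_univ x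
  have hsum := signedCliqueCount_univ_eq (G := unitSphere G x)
    (A := {y : G.neighborSet x | f y.1 < f x})
  rw [hS.signedCliqueCount_eq, sub_add_cancel] at hsum
  rw [index_eq_signedCliqueCount, index_eq_signedCliqueCount, hupper,
    eulerChar_eq_one_sub (centralSurfaceEmbedding G f x) (Set.toFinite _),
    range_centralSurfaceEmbedding hf, signedCliqueCount_mixedCliques]
  linarith

end CentralSurface

end GeomGraph

theorem mainTheorem5 {V : Type*} (G : SimpleGraph V) (d : ℕ)
    (hG : GeomGraph.IsDGraph (d : ℤ) G) (f : V → ℝ)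
    (hf : GeomGraph.LocallyInjective G f) (x : V) :
    GeomGraph.IsDGraph ((d : ℤ) - 2) (GeomGraph.centralSurface G f x) ∧
    (Odd d → GeomGraph.symmIndex G f x =
      -(GeomGraph.eulerChar (GeomGraph.centralSurface G f x) : ℚ) / 2) ∧
    (Even d → GeomGraph.symmIndex G f x =
      1 - (GeomGraph.eulerChar (GeomGraph.centralSurface G f x) : ℚ) / 2) := by
  have h := hG.index_add_index_neg hf x
  refine ⟨hG.centralSurface hf x, fun hd => ?_, fun hd => ?_⟩
  · rw [Int.negOnePow_odd _ (by exact_mod_cast hd)] at h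
    rw [GeomGraph.symmIndex, ← Int.cast_add, h]
    push_cast
    ring
  · rw [Int.negOnePow_even _ (by exact_mod_cast hd)] at h
    rw [GeomGraph.symmIndex, ← Int.cast_add, h]
    push_cast
    ring
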